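/- Theorem (random Brouwer fixed point theorem). Let $(\Omega,\mathcal F,P)$ be a probability space and $d\ge 0$ an integer. Let $L^0(\mathcal F)$ and $L^0(\mathcal F,\mathbb R^d)$ be the spaces of real random variables, respectively of random vectors in $\mathbb R^d$, modulo almost sure equality; all operations and inequalities between them are understood almost surely, and $\|x\|\in L^0(\mathcal F)$ denotes the class of $\omega\mapsto\|x(\omega)\|$, with the Euclidean norm on $\mathbb R^d$. Let $\mathcal T_c$ be the topology on $L^0(\mathcal F,\mathbb R^d)$ generated by the random open balls $\{y:\|x-y\|<r \text{ a.s.}\}$ with $x\in L^0(\mathcal F,\mathbb R^d)$, $r\in L^0(\mathcal F)$ and $r>0$ a.s. For a countable partition $(A_n)_{n\in\mathbb N}$ of $\Omega$ into (possibly empty) members of $\mathcal F$ and a sequence $(x_n)_{n\in\mathbb N}$ in $L^0(\mathcal F,\mathbb R^d)$, let $\sum_n I_{A_n}x_n$ be the class of the function that agrees with (a representative of) $x_n$ on $A_n$ for every $n$. Let $G\subseteq L^0(\mathcal F,\mathbb R^d)$ be a nonempty set with the following properties: (a) $G$ is $\sigma$-stable: $\sum_n I_{A_n}x_n\in G$ for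 every countable measurable partition $(A_n)$ of $\Omega$ and every sequence $(x_n)$ in $G$; (b) $G$ is a.s. bounded: the supremum $\bigvee\{\|x\|:x\in G\}$, taken in the complete lattice of classes of extended real random variables, belongs to $L^0_+(\mathcal F)=\{\xi\in L^0(\mathcal F):\xi\ge 0\}$; (c) $G$ is $\mathcal T_c$-closed; (d) $G$ is $L^0$-convex: $\lambda x+(1-\lambda)y\in G$ for all $x,y\in G$ and all $\lambda\in L^0(\mathcal F)$ with $0\le\lambda\le 1$. Let $f:G\to G$ be continuous for the topology induced by $\mathcal T_c$ on $G$, and $\sigma$-stable, that is, $f\bigl(\sum_n I_{A_n}x_n\bigr)=\sum_n I_{A_n}f(x_n)$ for every countable measurable partition $(A_n)$ of $\Omega$ and every sequence $(x_n)$ in $G$. Then $f$ has a fixed point: there is $x\in G$ with $f(x)=x$. -/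

import Mathlib

open MeasureTheory

namespace RandomBrouwer

universe u

variable {Ω : Type u} [MeasurableSpace Ω] {P : Measure Ω}

/-- `L⁰(F, E)`: classes of random elements of `E` modulo almost sure equality. For separable `E`
(as `ℝ` and `ℝᵈ` are) this is the space of classes of measurable functions `Ω → E`. -/
abbrev L0 (P : Measure Ω) (E : Type) [TopologicalSpace E] := Ω →ₘ[P] E

/-- `L⁰(F, ℝᵈ)`, where `ℝᵈ` carries the Euclidean norm. -/
abbrev L0Vec (P : Measure Ω) (d : ℕ) := L0 P (EuclideanSpace ℝ (Fin d))

variable {d : ℕ}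

/-- The `L⁰`-norm: the class of `ω ↦ ‖x ω‖`. -/
noncomputable def l0Norm (x : L0Vec P d) : L0 P ℝ :=
  AEEqFun.comp (fun v : EuclideanSpace ℝ (Fin d) => ‖v‖) continuous_norm x

/-- The module multiplication of `L⁰(F, ℝᵈ)` by `L⁰(F)`: the class of `ω ↦ c ω • x ω`. -/
noncomputable def l0Smul (c : L0 P ℝ) (x : L0Vec P d) : L0Vec P d :=
  AEEqFun.comp₂ (fun (a : ℝ) (v : EuclideanSpace ℝ (Fin d)) => a • v)
    (continuous_fst.smul continuous_snd) c x

/-- The inclusion of `L⁰(F)` in the lattice of classes of extended real random variables. -/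
noncomputable def toExtended (c : L0 P ℝ) : L0 P EReal :=
  AEEqFun.comp (fun a : ℝ => (a : EReal)) continuous_coe_real_ereal c

/-- `G` is a.s. bounded: the supremum of `{‖x‖ : x ∈ G}`, taken in the complete lattice of classes
of extended real random variables, belongs to `L⁰₊(F)`. -/
def AsBounded (G : Set (L0Vec P d)) : Prop :=
  ∃ η : L0 P ℝ, 0 ≤ η ∧ IsLUB ((fun x => toExtended (l0Norm x)) '' G) (toExtended η)

/-- `G` is `L⁰`-convex. -/
def L0Convex (G : Set (L0Vec P d)) : Prop :=
  ∀ x ∈ G, ∀ y ∈ G, ∀ c : L0 P ℝ, 0 ≤ c → c ≤ 1 → l0Smul c x + l0Smul (1 - c) y ∈ G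

/-- The random open ball `{y : ‖x - y‖ < r on Ω}`. -/
def randomBall (x : L0Vec P d) (r : L0 P ℝ) : Set (L0Vec P d) :=
  {y | ∀ᵐ ω ∂P, l0Norm (x - y) ω < r ω}

/-- The topology `T_c`, generated by the random open balls whose radius is strictly positive
on `Ω`. -/
@[reducible]
def topologyC (P : Measure Ω) (d : ℕ) : TopologicalSpace (L0Vec P d) :=
  TopologicalSpace.generateFrom
    {U | ∃ (x : L0Vec P d) (r : L0 P ℝ), (∀ᵐ ω ∂P, 0 < r ω) ∧ U = randomBall x r}

/-- `G` is closed in the topology `T_c`. -/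
def TcClosed (G : Set (L0Vec P d)) : Prop :=
  @IsClosed _ (topologyC P d) G

/-- `f` is continuous when `G` carries the subspace topology of `T_c`. -/
def TcContinuous {G : Set (L0Vec P d)} (f : G → G) : Prop :=
  @Continuous G G ((topologyC P d).induced Subtype.val) ((topologyC P d).induced Subtype.val) f

/-- Countable partitions of `Ω` into measurable sets (empty pieces are allowed). -/
structure IsPartition (A : ℕ → Set Ω) : Prop where
  measurableSet : ∀ n, MeasurableSet (A n)
  disjoint : ∀ m n, m ≠ n → Disjoint (A m) (A n)
  iUnion_eq : ⋃ n, A n = Set.univ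

/-- The index of the piece of the partition which contains `ω`. -/
noncomputable def IsPartition.index {A : ℕ → Set Ω} (hA : IsPartition A) (ω : Ω) : ℕ :=
  (Set.mem_iUnion.1 (hA.iUnion_eq.symm ▸ Set.mem_univ ω : ω ∈ ⋃ n, A n)).choose

theorem IsPartition.mem_index {A : ℕ → Set Ω} (hA : IsPartition A) (ω : Ω) :
    ω ∈ A (hA.index ω) :=
  (Set.mem_iUnion.1 (hA.iUnion_eq.symm ▸ Set.mem_univ ω : ω ∈ ⋃ n, A n)).choose_spec

theorem IsPartition.index_eq {A : ℕ → Set Ω} (hA : IsPartition A) {ω : Ω} {n : ℕ}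
    (h : ω ∈ A n) : hA.index ω = n := by
  by_contra hne
  exact Set.disjoint_left.1 (hA.disjoint _ _ hne) (hA.mem_index ω) h

theorem IsPartition.aestronglyMeasurable {A : ℕ → Set Ω} (hA : IsPartition A)
    (x : ℕ → L0Vec P d) : AEStronglyMeasurable (fun ω => x (hA.index ω) ω) P := by
  have h : AEStronglyMeasurable (fun ω => x (hA.index ω) ω) (P.restrict (⋃ n, A n)) := by
    rw [aestronglyMeasurable_iUnion_iff]
    intro n
    refine (x n).aestronglyMeasurable.restrict.congr ?_
    filter_upwards [ae_restrict_mem (hA.measurableSet n)] with ω hω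
    rw [hA.index_eq hω]
  rwa [hA.iUnion_eq, Measure.restrict_univ] at h

/-- The countable concatenation `∑ n, I_{A n} x n`: the class of the function which is equal
to `x n` on `A n`. -/
noncomputable def concat {A : ℕ → Set Ω} (hA : IsPartition A) (x : ℕ → L0Vec P d) : L0Vec P d :=
  AEEqFun.mk (fun ω => x (hA.index ω) ω) (hA.aestronglyMeasurable x)

/-- `G` contains the countable concatenations of its sequences. -/
def SigmaStable (G : Set (L0Vec P d)) : Prop :=
  ∀ (A : ℕ → Set Ω) (hA : IsPartition A) (x : ℕ → L0Vec P d), (∀ n, x n ∈ G) → concat hA x ∈ G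

/-- A self-map of a `σ`-stable set is `σ`-stable if it commutes with countable concatenations. -/
def SigmaStableMap {G : Set (L0Vec P d)} (hG : SigmaStable G) (f : G → G) : Prop :=
  ∀ (A : ℕ → Set Ω) (hA : IsPartition A) (x : ℕ → G),
    (f ⟨concat hA fun n => (x n : L0Vec P d), hG A hA _ fun n => (x n).2⟩ : L0Vec P d) =
      concat hA fun n => (f (x n) : L0Vec P d)

end RandomBrouwer

/-! Fixing ω and applying Brouwer there is not available: `f` acts on classes of random vectors, not
on points. The proof instead runs a combinatorial Brouwer argument on countably many random vectors
and makes every choice measurably in ω. The problem is first moved from `G` to the whole space.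
Since `G` is closed, bounded and convex, every random vector has a projection `r x` to `G`
(`exists_projection`), and `r` is almost surely 1-Lipschitz pointwise in ω. The map `g = f ∘ r` then
has bounded range, is local (its value on an event depends only on its argument there) and respects
almost sure convergence. Locality comes from σ-stability; respect for almost sure convergence comes
from continuity and locality together (`TcContinuous.tendsto_ae`). A fixed point of `g` lies in `G`,
so it equals its own projection and is fixed by `f`. For `g`, a cube of random half-side ρ
containing its range is subdivided. For almost every ω, Kuhn's cubical lemma (`exists_kuhn_cell`)
gives a cell in which, for each coordinate, `g` moves one corner weakly up and another strictly
down. Cells range over a countable set, so they can be chosen measurably. A random form of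
Bolzano–Weierstrass makes the cells shrink to a random vector `x`; locality identifies `g` at glued
corners with `g` at lattice points, and passing to the limit gives both inequalities between `g x`
and `x`. -/

namespace RandomBrouwer

/-! ### Kuhn's cubical lemma by a mod 2 Stokes argument -/

section Kuhn

variable {ι : Type*} [DecidableEq ι]

/-- Differential forms with coefficients in `ZMod 2` on the lattice `ι → ℕ`: the value at `J` is
the coefficient function of the product of the `dxⱼ` with `j ∈ J`. -/
abbrev LatticeForm (ι : Type*) := Finset ι → (ι → ℕ) → ZMod 2

/-- The exterior derivative of a lattice form, built from forward differences. -/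
def latticeDeriv (w : LatticeForm ι) : LatticeForm ι := fun J q =>
  ∑ j ∈ J, (w (J.erase j) (q + Pi.single j 1) + w (J.erase j) q)

/-- The product of a function with a lattice form. -/
def latticeMul (a : (ι → ℕ) → ZMod 2) (w : LatticeForm ι) : LatticeForm ι := fun J q =>
  a q * w J q

/-- The exterior product of the derivative of a function with a lattice form. -/
def gradWedge (a : (ι → ℕ) → ZMod 2) (w : LatticeForm ι) : LatticeForm ι := fun J q =>
  ∑ j ∈ J, (a q + a (q + Pi.single j 1)) * w (J.erase j) (q + Pi.single j 1)

/-- The exterior product of the derivatives of a list of functions. -/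
def gradProd : List ((ι → ℕ) → ZMod 2) → LatticeForm ι
  | [] => fun J _ => if J = ∅ then 1 else 0
  | a :: l => gradWedge a (gradProd l)

/-- The Leibniz rule is exact because `gradWedge` evaluates the form at the shifted point; the two
cross terms cancel mod 2. -/
theorem latticeDeriv_mul (a : (ι → ℕ) → ZMod 2) (w : LatticeForm ι) :
    latticeDeriv (latticeMul a w) = gradWedge a w + latticeMul a (latticeDeriv w) := by
  funext J q
  simp only [latticeDeriv, latticeMul, gradWedge, Pi.add_apply, Finset.mul_sum,
    ← Finset.sum_add_distrib]
  refine Finset.sum_congr rfl fun j _ => ?_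
  linear_combination -(CharTwo.add_self_eq_zero (a q * w (J.erase j) (q + Pi.single j 1)))

/-- Mixed differences commute, so the terms for (j, k) and (k, j) cancel mod 2; no signs are needed.
-/
theorem latticeDeriv_latticeDeriv (w : LatticeForm ι) : latticeDeriv (latticeDeriv w) = 0 := by
  funext J q
  simp only [latticeDeriv, Pi.zero_apply, ← Finset.sum_add_distrib]
  rw [Finset.sum_sigma']
  refine Finset.sum_involution (fun x _ => ⟨x.2, x.1⟩) ?_ ?_ ?_ ?_
  · rintro ⟨j, k⟩ _
    simp only [Finset.erase_right_comm (a := k) (b := j), add_right_comm q (Pi.single k 1)]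
    generalize w ((J.erase j).erase k) = u
    have h := fun x => CharTwo.add_self_eq_zero (u x)
    linear_combination h (q + Pi.single j 1 + Pi.single k 1) + h (q + Pi.single j 1) +
      h (q + Pi.single k 1) + h q
  · rintro ⟨j, k⟩ h _ he
    simp only [Finset.mem_sigma, Finset.mem_erase] at h
    exact h.2.1 (congrArg Sigma.fst he)
  · rintro ⟨j, k⟩ h
    simp only [Finset.mem_sigma, Finset.mem_erase] at h ⊢
    exact ⟨h.2.2, Ne.symm h.2.1, h.1⟩
  · rintro ⟨j, k⟩ _
    rfl

theorem gradWedge_eq_latticeDeriv (a : (ι → ℕ) → ZMod 2) {w : LatticeForm ι}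
    (hw : latticeDeriv w = 0) : gradWedge a w = latticeDeriv (latticeMul a w) := by
  rw [latticeDeriv_mul, hw]
  funext J q
  simp [latticeMul]

theorem latticeDeriv_gradProd (l : List ((ι → ℕ) → ZMod 2)) :
    latticeDeriv (gradProd l) = 0 := by
  induction l with
  | nil =>
    funext J q
    exact Finset.sum_eq_zero fun j _ => CharTwo.add_self_eq_zero _
  | cons a l ih =>
    rw [gradProd, gradWedge_eq_latticeDeriv a ih, latticeDeriv_latticeDeriv]

/-- The restriction of a product of differentials to a face vanishes if one of the functions is
constant on that face: steps in directions other than `j` never leave it. -/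
theorem gradProd_eq_zero {l : List ((ι → ℕ) → ZMod 2)} {a : (ι → ℕ) → ZMod 2} (ha : a ∈ l)
    {j : ι} {c : ℕ} {v : ZMod 2} (hav : ∀ q : ι → ℕ, q j = c → a q = v) {K : Finset ι}
    (hj : j ∉ K) {q : ι → ℕ} (hq : q j = c) : gradProd l K q = 0 := by
  induction l generalizing K q with
  | nil => simp at ha
  | cons b l ih =>
    refine Finset.sum_eq_zero fun k hk => ?_
    have hkj : j ≠ k := fun h => hj (h ▸ hk)
    have hq' : (q + Pi.single k 1 : ι → ℕ) j = c := by simp [Pi.single_eq_of_ne hkj, hq]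
    rcases List.mem_cons.1 ha with rfl | ha
    · rw [hav _ hq, hav _ hq', CharTwo.add_self_eq_zero, zero_mul]
    · rw [ih ha (fun h => hj (Finset.mem_of_mem_erase h)) hq', mul_zero]

/-- A nonzero coefficient contains a nonzero product of differences along a lattice path inside the
cell, and each function changes along its own step. -/
theorem exists_ne_of_gradProd_ne_zero {l : List ((ι → ℕ) → ZMod 2)} {K : Finset ι}
    {q : ι → ℕ} (h : gradProd l K q ≠ 0) {a : (ι → ℕ) → ZMod 2} (ha : a ∈ l) :
    ∃ r s : ι → ℕ, (∀ i, q i ≤ r i ∧ r i ≤ q i + if i ∈ K then 1 else 0) ∧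
      (∀ i, q i ≤ s i ∧ s i ≤ q i + if i ∈ K then 1 else 0) ∧ a r ≠ a s := by
  induction l generalizing K q with
  | nil => simp at ha
  | cons b l ih =>
    obtain ⟨k, hk, hne⟩ := Finset.exists_ne_zero_of_sum_ne_zero h
    rcases List.mem_cons.1 ha with rfl | ha
    · refine ⟨q, q + Pi.single k 1, fun i => ⟨le_rfl, by simp⟩, fun i => ⟨by simp, ?_⟩,
        fun he => hne ?_⟩
      · rcases eq_or_ne i k with rfl | hik
        · simp [hk]
        · simp [Pi.single_eq_of_ne hik]
      · rw [← he, CharTwo.add_self_eq_zero, zero_mul]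
    · obtain ⟨r, s, hr, hs, hrs⟩ := ih (right_ne_zero_of_mul hne) ha
      have key : ∀ t : ι → ℕ, (∀ i, (q + Pi.single k 1 : ι → ℕ) i ≤ t i ∧
          t i ≤ (q + Pi.single k 1 : ι → ℕ) i + if i ∈ K.erase k then 1 else 0) →
          ∀ i, q i ≤ t i ∧ t i ≤ q i + if i ∈ K then 1 else 0 := by
        intro t ht i
        have := ht i
        rcases eq_or_ne i k with rfl | hik
        · simp [hk] at this ⊢
          omega
        · simpa [hik] using this
      exact ⟨r, s, key r hr, key s hs, hrs⟩

variable [Fintype ι]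

/-- The lattice points whose coordinates in `J` are less than `p` and whose other coordinates are
those of `b`. -/
def latticeBox (p : ℕ) (J : Finset ι) (b : ι → ℕ) : Finset (ι → ℕ) :=
  Fintype.piFinset fun i => if i ∈ J then Finset.range p else {b i}

theorem mem_latticeBox {p : ℕ} {J : Finset ι} {b q : ι → ℕ} :
    q ∈ latticeBox p J b ↔ ∀ i, if i ∈ J then q i < p else q i = b i := by
  simp only [latticeBox, Fintype.mem_piFinset]
  refine forall_congr' fun i => ?_
  split_ifs <;> simp

theorem mem_latticeBox_erase {p : ℕ} {J : Finset ι} {b q : ι → ℕ} {j : ι} {t : ℕ} :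
    q ∈ latticeBox p (J.erase j) (Function.update b j t) ↔
      q j = t ∧ ∀ i, i ≠ j → if i ∈ J then q i < p else q i = b i := by
  rw [mem_latticeBox]
  constructor
  · intro h
    refine ⟨by simpa using h j, fun i hi => by simpa [hi] using h i⟩
  · rintro ⟨h1, h2⟩ i
    rcases eq_or_ne i j with rfl | hi
    · simpa using h1
    · simpa [hi] using h2 i hi

theorem sum_latticeBox {p : ℕ} {J : Finset ι} {j : ι} (hj : j ∈ J) (b : ι → ℕ)
    (h : (ι → ℕ) → ZMod 2) : ∑ q ∈ latticeBox p J b, h q =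
      ∑ t ∈ Finset.range p, ∑ q ∈ latticeBox p (J.erase j) (Function.update b j t), h q := by
  have hmaps : ∀ q ∈ latticeBox p J b, q j ∈ Finset.range p := fun q hq => by
    simpa [hj] using mem_latticeBox.1 hq j
  rw [← Finset.sum_fiberwise_of_maps_to hmaps]
  refine Finset.sum_congr rfl fun t ht => Finset.sum_congr ?_ fun _ _ => rfl
  ext q
  rw [Finset.mem_filter, mem_latticeBox_erase, mem_latticeBox]
  constructor
  · exact fun ⟨h1, h2⟩ => ⟨h2, fun i _ => h1 i⟩
  · refine fun ⟨h1, h2⟩ => ⟨fun i => ?_, h1⟩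
    rcases eq_or_ne i j with rfl | hi
    · simpa [hj, h1] using ht
    · exact h2 i hi

theorem sum_latticeBox_shift {p : ℕ} {J : Finset ι} {j : ι} (b : ι → ℕ) (t : ℕ)
    (h : (ι → ℕ) → ZMod 2) :
    ∑ q ∈ latticeBox p (J.erase j) (Function.update b j t), h (q + Pi.single j 1) =
      ∑ q ∈ latticeBox p (J.erase j) (Function.update b j (t + 1)), h q := by
  refine Finset.sum_bij' (fun q _ => q + Pi.single j 1) (fun q _ => q - Pi.single j 1)
    ?_ ?_ ?_ ?_ fun _ _ => rfl
  · intro q hq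
    rw [mem_latticeBox_erase] at hq ⊢
    exact ⟨by simp [hq.1], fun i hi => by simpa [hi] using hq.2 i hi⟩
  · intro q hq
    rw [mem_latticeBox_erase] at hq ⊢
    exact ⟨by simp [hq.1], fun i hi => by simpa [hi] using hq.2 i hi⟩
  · intro q _
    exact add_tsub_cancel_right q _
  · intro q hq
    rw [mem_latticeBox_erase] at hq
    refine tsub_add_cancel_of_le fun i => ?_
    rcases eq_or_ne i j with rfl | hi
    · simp [hq.1]
    · simp [hi]

/-- The discrete fundamental theorem of calculus in one coordinate direction. -/
theorem sum_latticeBox_diff {p : ℕ} {J : Finset ι} {j : ι} (hj : j ∈ J) (b : ι → ℕ)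
    (h : (ι → ℕ) → ZMod 2) : ∑ q ∈ latticeBox p J b, (h (q + Pi.single j 1) + h q) =
      ∑ q ∈ latticeBox p (J.erase j) (Function.update b j p), h q +
        ∑ q ∈ latticeBox p (J.erase j) (Function.update b j 0), h q := by
  rw [sum_latticeBox hj]
  simp only [Finset.sum_add_distrib, sum_latticeBox_shift]
  have := Finset.sum_range_sub
    (fun t => ∑ q ∈ latticeBox p (J.erase j) (Function.update b j t), h q) p
  simpa only [CharTwo.sub_eq_add, Finset.sum_add_distrib] using this

/-- A degree computation by Stokes: the product is the derivative of `a k` times the remaining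
product. Faces normal to other directions contribute nothing, nor does the face where `a k = 0`; the
face where `a k = 1` leaves the same sum in one dimension less. -/
theorem sum_gradProd {p : ℕ} {a : ι → (ι → ℕ) → ZMod 2} (h0 : ∀ j q, q j = 0 → a j q = 0)
    (h1 : ∀ j q, q j = p → a j q = 1) (l : List ι) (hl : l.Nodup) (b : ι → ℕ) :
    ∑ q ∈ latticeBox p l.toFinset b, gradProd (l.map a) l.toFinset q = 1 := by
  induction l generalizing b with
  | nil =>
    have : latticeBox p ∅ b = {b} := by
      ext q
      simp [mem_latticeBox, funext_iff]
    simp [gradProd, this]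
  | cons k l ih =>
    rw [List.nodup_cons] at hl
    have herase : (k :: l).toFinset.erase k = l.toFinset := by
      rw [List.toFinset_cons, Finset.erase_insert (by simpa using hl.1)]
    rw [List.map_cons, gradProd, gradWedge_eq_latticeDeriv _ (latticeDeriv_gradProd _)]
    simp only [latticeDeriv]
    rw [Finset.sum_comm]
    have hk : k ∈ (k :: l).toFinset := by simp
    rw [Finset.sum_congr rfl fun j hj => sum_latticeBox_diff hj b _,
      Finset.sum_eq_single_of_mem k hk]
    · rw [herase, ← ih hl.2 (Function.update b k p)]
      refine (congrArg₂ (· + ·) (Finset.sum_congr rfl fun q hq => ?_)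
        (Finset.sum_eq_zero fun q hq => ?_)).trans (add_zero _)
      · rw [← herase, mem_latticeBox_erase] at hq
        rw [latticeMul, h1 k q hq.1, one_mul]
      · rw [← herase, mem_latticeBox_erase] at hq
        rw [latticeMul, h0 k q hq.1, zero_mul]
    · intro j hj hjk
      have hjl : a j ∈ l.map a := by
        refine List.mem_map_of_mem ?_
        simpa [hjk] using hj
      rw [Finset.sum_eq_zero, Finset.sum_eq_zero, add_zero]
      · intro q hq
        rw [mem_latticeBox_erase] at hq
        rw [latticeMul, gradProd_eq_zero hjl (h0 j) (Finset.notMem_erase j _) hq.1, mul_zero]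
      · intro q hq
        rw [mem_latticeBox_erase] at hq
        rw [latticeMul, gradProd_eq_zero hjl (h1 j) (Finset.notMem_erase j _) hq.1, mul_zero]

/-- Kuhn's cubical lemma. -/
theorem exists_kuhn_cell {p : ℕ} {S : ι → (ι → ℕ) → Prop} (h0 : ∀ j q, q j = 0 → ¬ S j q)
    (h1 : ∀ j q, q j = p → S j q) :
    ∃ q : ι → ℕ, (∀ i, q i < p) ∧ ∀ j, ∃ r s : ι → ℕ, (∀ i, q i ≤ r i ∧ r i ≤ q i + 1) ∧
      (∀ i, q i ≤ s i ∧ s i ≤ q i + 1) ∧ ¬ S j r ∧ S j s := by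
  classical
  -- Apply the degree formula to the indicators of the `S j`. The total is odd, so some cell has a
  -- nonzero coefficient, and every indicator varies on it. The base point 0 plays no role, since
  -- all coordinates are free.
  have hsum := sum_gradProd (p := p) (a := fun j q => if S j q then 1 else 0)
    (fun j q h => if_neg (h0 j q h)) (fun j q h => if_pos (h1 j q h)) Finset.univ.toList
    (Finset.nodup_toList _) 0
  rw [Finset.toList_toFinset] at hsum
  obtain ⟨q, hq, hne⟩ := Finset.exists_ne_zero_of_sum_ne_zero (hsum.trans_ne one_ne_zero)
  refine ⟨q, fun i => by simpa using mem_latticeBox.1 hq i, fun j => ?_⟩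
  obtain ⟨r, s, hr, hs, hrs⟩ := exists_ne_of_gradProd_ne_zero hne
    (List.mem_map_of_mem (Finset.mem_toList.2 (Finset.mem_univ j)))
  simp only [Finset.mem_univ, if_true] at hr hs
  by_cases hSr : S j r <;> by_cases hSs : S j s <;> simp [hSr, hSs] at hrs
  · exact ⟨s, r, hs, hr, hSs, hSr⟩
  · exact ⟨r, s, hr, hs, hSr, hSs⟩

end Kuhn

end RandomBrouwer

namespace RandomBrouwer

/-! ### The topology of random balls, gluing, and locality -/

section RandomVectors

open Filter Topology

universe u

variable {Ω : Type u} [MeasurableSpace Ω] {P : Measure Ω} {d : ℕ}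

theorem coeFn_l0Norm (x : L0Vec P d) : l0Norm x =ᵐ[P] fun ω => ‖x ω‖ :=
  AEEqFun.coeFn_comp _ _ _

theorem coeFn_l0Smul (c : L0 P ℝ) (x : L0Vec P d) : l0Smul c x =ᵐ[P] fun ω => c ω • x ω :=
  AEEqFun.coeFn_comp₂ _ _ _ _

theorem mem_randomBall {x y : L0Vec P d} {r : L0 P ℝ} :
    y ∈ randomBall x r ↔ ∀ᵐ ω ∂P, ‖x ω - y ω‖ < r ω := by
  change (∀ᵐ ω ∂P, l0Norm (x - y) ω < r ω) ↔ _
  refine eventually_congr ?_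
  filter_upwards [coeFn_l0Norm (x - y), AEEqFun.coeFn_sub x y] with ω h1 h2
  rw [h1, h2, Pi.sub_apply]

theorem isOpen_randomBall (x : L0Vec P d) {r : L0 P ℝ} (hr : ∀ᵐ ω ∂P, 0 < r ω) :
    IsOpen[topologyC P d] (randomBall x r) :=
  TopologicalSpace.isOpen_generateFrom_of_mem ⟨x, r, hr, rfl⟩

/-- Random balls are only a subbase by definition; the triangle inequality and pointwise minima of
radii make centred balls a neighbourhood base. -/
theorem exists_randomBall_subset {U : Set (L0Vec P d)} (hU : IsOpen[topologyC P d] U)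
    {y : L0Vec P d} (hy : y ∈ U) :
    ∃ ε : L0 P ℝ, (∀ᵐ ω ∂P, 0 < ε ω) ∧ randomBall y ε ⊆ U := by
  change TopologicalSpace.GenerateOpen _ U at hU
  induction hU with
  | basic V hV =>
    obtain ⟨x, r, -, rfl⟩ := hV
    have hc : r - l0Norm (x - y) =ᵐ[P] fun ω => r ω - ‖x ω - y ω‖ := by
      filter_upwards [coeFn_l0Norm (x - y), AEEqFun.coeFn_sub x y,
        AEEqFun.coeFn_sub r (l0Norm (x - y))] with ω h1 h2 h3
      rw [h3, Pi.sub_apply, h1, h2, Pi.sub_apply]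
    refine ⟨r - l0Norm (x - y), ?_, fun z hz => ?_⟩
    · filter_upwards [hc, mem_randomBall.1 hy] with ω h1 h2
      rw [h1]
      exact sub_pos.2 h2
    · rw [mem_randomBall] at hz ⊢
      filter_upwards [hz, hc] with ω h1 h2
      rw [h2] at h1
      linarith [norm_sub_le_norm_sub_add_norm_sub (x ω) (y ω) (z ω)]
  | univ =>
    refine ⟨1, ?_, Set.subset_univ _⟩
    filter_upwards [AEEqFun.coeFn_one (α := Ω) (β := ℝ) (μ := P)] with ω h
    rw [h]
    exact one_pos
  | inter V W _ _ ihV ihW =>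
    obtain ⟨ε, hε, hV⟩ := ihV hy.1
    obtain ⟨δ, hδ, hW⟩ := ihW hy.2
    refine ⟨ε ⊓ δ, ?_, fun z hz => ⟨hV ?_, hW ?_⟩⟩
    · filter_upwards [AEEqFun.coeFn_inf ε δ, hε, hδ] with ω h h1 h2
      rw [h]
      exact lt_min h1 h2
    · rw [mem_randomBall] at hz ⊢
      filter_upwards [AEEqFun.coeFn_inf ε δ, hz] with ω h h1
      rw [h] at h1
      exact h1.trans_le inf_le_left
    · rw [mem_randomBall] at hz ⊢
      filter_upwards [AEEqFun.coeFn_inf ε δ, hz] with ω h h1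
      rw [h] at h1
      exact h1.trans_le inf_le_right
  | sUnion S _ ih =>
    obtain ⟨V, hV, hyV⟩ := hy
    obtain ⟨ε, hε, h⟩ := ih V hV hyV
    exact ⟨ε, hε, h.trans (Set.subset_sUnion_of_mem hV)⟩

theorem isPartition_fiber {N : Ω → ℕ} (hN : Measurable N) : IsPartition fun n => N ⁻¹' {n} where
  measurableSet n := hN (measurableSet_singleton n)
  disjoint _ _ hmn := Set.disjoint_left.2 fun _ h1 h2 => hmn (h1.symm.trans h2)
  iUnion_eq := Set.eq_univ_of_forall fun ω => Set.mem_iUnion.2 ⟨N ω, rfl⟩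

theorem coeFn_concat_fiber {N : Ω → ℕ} (hN : Measurable N) (x : ℕ → L0Vec P d) :
    concat (isPartition_fiber hN) x =ᵐ[P] fun ω => x (N ω) ω := by
  filter_upwards [AEEqFun.coeFn_mk (μ := P) _ ((isPartition_fiber hN).aestronglyMeasurable x)]
    with ω h
  rw [concat, h, (isPartition_fiber hN).index_eq (show ω ∈ N ⁻¹' {N ω} from rfl)]

theorem concat_fiber_eq {N : Ω → ℕ} (hN : Measurable N) {x : ℕ → L0Vec P d} {y : L0Vec P d}
    (hy : ∀ᵐ ω ∂P, y ω = x (N ω) ω) : concat (isPartition_fiber hN) x = y := by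
  refine AEEqFun.ext ?_
  filter_upwards [coeFn_concat_fiber hN x, hy] with ω h1 h2
  rw [h1, h2]

theorem SigmaStable.mem_of_ae_eq {G : Set (L0Vec P d)} (hG : SigmaStable G) {N : Ω → ℕ}
    (hN : Measurable N) {x : ℕ → L0Vec P d} (hx : ∀ n, x n ∈ G) {y : L0Vec P d}
    (hy : ∀ᵐ ω ∂P, y ω = x (N ω) ω) : y ∈ G :=
  concat_fiber_eq hN hy ▸ hG _ (isPartition_fiber hN) x hx

/-- Gluing countably many random vectors along a measurable random index. -/
theorem exists_glue {T : Type*} [Countable T] [MeasurableSpace T] [MeasurableSingletonClass T]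
    {N : Ω → T} (hN : Measurable N) (x : T → L0Vec P d) :
    ∃ y : L0Vec P d, ∀ᵐ ω ∂P, y ω = x (N ω) ω := by
  have h : Measurable fun p : T × Ω => x p.1 p.2 :=
    measurable_from_prod_countable_right fun t => (x t).measurable
  have h' : Measurable fun ω => x (N ω) ω := h.comp (hN.prodMk measurable_id)
  exact ⟨AEEqFun.mk _ h'.aestronglyMeasurable, AEEqFun.coeFn_mk _ _⟩

theorem SigmaStable.exists_piecewise {G : Set (L0Vec P d)} (hG : SigmaStable G) {x y : L0Vec P d}
    (hx : x ∈ G) (hy : y ∈ G) {A : Set Ω} (hA : MeasurableSet A) :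
    ∃ z ∈ G, ∀ᵐ ω ∂P, (ω ∈ A → z ω = x ω) ∧ (ω ∉ A → z ω = y ω) := by
  classical
  have hN : Measurable fun ω => if ω ∈ A then 0 else 1 :=
    Measurable.ite hA measurable_const measurable_const
  obtain ⟨z, hz⟩ := exists_glue (P := P) hN fun n : ℕ => if n = 0 then x else y
  refine ⟨z, hG.mem_of_ae_eq hN (x := fun n : ℕ => if n = 0 then x else y) (fun n => ?_) hz, ?_⟩
  · split_ifs <;> assumption
  · filter_upwards [hz] with ω h
    by_cases hω : ω ∈ A <;> simp [hω, h]

/-- A random index in a countable type can be selected measurably. -/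
theorem exists_measurable_index {T : Type*} [Countable T] [Nonempty T] [MeasurableSpace T]
    {M : T → Set Ω} (hM : ∀ t, MeasurableSet (M t)) (h : ∀ᵐ ω ∂P, ∃ t, ω ∈ M t) :
    ∃ N : Ω → T, Measurable N ∧ ∀ᵐ ω ∂P, ω ∈ M (N ω) := by
  classical
  obtain ⟨e, he⟩ := exists_surjective_nat T
  -- The second alternative makes the search for the least index succeed also on the exceptional
  -- null set.
  have hex : ∀ ω, ∃ n, ω ∈ M (e n) ∨ ω ∉ ⋃ t, M t := fun ω => by
    by_cases hω : ω ∈ ⋃ t, M t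
    · obtain ⟨t, ht⟩ := Set.mem_iUnion.1 hω
      obtain ⟨n, rfl⟩ := he t
      exact ⟨n, Or.inl ht⟩
    · exact ⟨0, Or.inr hω⟩
  refine ⟨fun ω => e (Nat.find (hex ω)), measurable_from_nat.comp (measurable_find hex fun n =>
    (hM (e n)).union (MeasurableSet.iUnion hM).compl), ?_⟩
  filter_upwards [h] with ω hω
  exact (Nat.find_spec (hex ω)).resolve_right fun h' => h' (Set.mem_iUnion.2 hω)

/-- Almost sure convergence need not imply convergence in the random ball topology; σ-stability
bridges the gap. A random ball around `x` missing `G` would contain the gluing of the `y n` along a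
random index at which they are close enough, and that gluing is in `G`. -/
theorem TcClosed.mem_of_tendsto {G : Set (L0Vec P d)} (hc : TcClosed G) (hG : SigmaStable G)
    {y : ℕ → L0Vec P d} (hy : ∀ n, y n ∈ G) {x : L0Vec P d}
    (h : ∀ᵐ ω ∂P, Tendsto (fun n => y n ω) atTop (𝓝 (x ω))) : x ∈ G := by
  by_contra hx
  obtain ⟨ε, hε, hsub⟩ := exists_randomBall_subset
    (@IsClosed.isOpen_compl _ (topologyC P d) G hc) (Set.mem_compl hx)
  obtain ⟨N, hN, hNmem⟩ := exists_measurable_index (P := P)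
    (M := fun n => {ω | ‖x ω - y n ω‖ < ε ω})
    (fun n => measurableSet_lt (x.measurable.sub (y n).measurable).norm ε.measurable) (by
      filter_upwards [h, hε] with ω h1 h2
      obtain ⟨n, hn⟩ := ((tendsto_iff_norm_sub_tendsto_zero.1 h1).eventually_lt_const h2).exists
      exact ⟨n, (norm_sub_rev _ _).trans_lt hn⟩)
  obtain ⟨z, hz⟩ := exists_glue (P := P) hN y
  refine hsub (mem_randomBall.2 ?_) (hG.mem_of_ae_eq hN hy hz)
  filter_upwards [hNmem, hz] with ω h1 h2
  rw [h2]
  exact h1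

/-- A `σ`-stable map depends locally on its argument. -/
theorem SigmaStableMap.congr_on {G : Set (L0Vec P d)} {hG : SigmaStable G} {f : G → G}
    (hf : SigmaStableMap hG f) {A : Set Ω} (hA : MeasurableSet A) {x y : G}
    (h : ∀ᵐ ω ∂P, ω ∈ A → (x : L0Vec P d) ω = (y : L0Vec P d) ω) :
    ∀ᵐ ω ∂P, ω ∈ A → (f x : L0Vec P d) ω = (f y : L0Vec P d) ω := by
  classical
  have hN : Measurable fun ω => if ω ∈ A then 0 else 1 :=
    Measurable.ite hA measurable_const measurable_const
  have key := hf _ (isPartition_fiber hN) fun n => if n = 0 then x else y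
  have hy : concat (isPartition_fiber hN) (fun n => ((if n = 0 then x else y : G) : L0Vec P d)) =
      y := by
    refine concat_fiber_eq hN ?_
    filter_upwards [h] with ω hω
    by_cases hωA : ω ∈ A <;> simp [hωA, hω]
  rw [show (⟨concat (isPartition_fiber hN) fun n => ((if n = 0 then x else y : G) : L0Vec P d),
    _⟩ : G) = y from Subtype.ext hy] at key
  filter_upwards [coeFn_concat_fiber hN fun n => (f (if n = 0 then x else y) : L0Vec P d)]
    with ω hω hωA
  rw [key, hω]
  simp [hωA]

theorem TcContinuous.exists_randomBall {G : Set (L0Vec P d)} {f : G → G} (hf : TcContinuous f)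
    (x : G) {r : L0 P ℝ} (hr : ∀ᵐ ω ∂P, 0 < r ω) :
    ∃ δ : L0 P ℝ, (∀ᵐ ω ∂P, 0 < δ ω) ∧
      ∀ z : G, (z : L0Vec P d) ∈ randomBall (x : L0Vec P d) δ →
        (f z : L0Vec P d) ∈ randomBall (f x : L0Vec P d) r := by
  let _ : TopologicalSpace (L0Vec P d) := topologyC P d
  have hopen : IsOpen (Subtype.val ⁻¹' randomBall (f x : L0Vec P d) r : Set G) :=
    ⟨_, isOpen_randomBall _ hr, rfl⟩
  obtain ⟨V, hV, hVeq⟩ := hopen.preimage (show Continuous f from hf)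
  have hxV : x ∈ (Subtype.val ⁻¹' V : Set G) := by
    rw [hVeq]
    refine mem_randomBall.2 ?_
    filter_upwards [hr] with ω h
    simpa using h
  obtain ⟨δ, hδ, hsub⟩ := exists_randomBall_subset hV hxV
  refine ⟨δ, hδ, fun z hz => ?_⟩
  have : z ∈ (Subtype.val ⁻¹' V : Set G) := hsub hz
  rwa [hVeq] at this

/-- A continuous `σ`-stable map respects almost sure convergence of sequences. -/
theorem TcContinuous.tendsto_ae {G : Set (L0Vec P d)} {hG : SigmaStable G} {f : G → G}
    (hc : TcContinuous f) (hf : SigmaStableMap hG f) {y : ℕ → G} {x : G}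
    (h : ∀ᵐ ω ∂P, Tendsto (fun n => (y n : L0Vec P d) ω) atTop (𝓝 ((x : L0Vec P d) ω))) :
    ∀ᵐ ω ∂P, Tendsto (fun n => (f (y n) : L0Vec P d) ω) atTop (𝓝 ((f x : L0Vec P d) ω)) := by
  have hr : ∀ k : ℕ, AEEqFun.const (μ := P) Ω (1 / ((k : ℝ) + 1)) =ᵐ[P]
      fun _ => 1 / ((k : ℝ) + 1) := fun k => AEEqFun.coeFn_const _ _
  have hball := fun k : ℕ => hc.exists_randomBall x
    (r := AEEqFun.const Ω (1 / ((k : ℝ) + 1))) (by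
      filter_upwards [hr k] with ω hω
      rw [hω]
      positivity)
  choose δ hδ hδf using hball
  have hloc : ∀ᵐ ω ∂P, ∀ k n : ℕ, ‖(x : L0Vec P d) ω - (y n : L0Vec P d) ω‖ < δ k ω →
      ‖(f x : L0Vec P d) ω - (f (y n) : L0Vec P d) ω‖ < 1 / ((k : ℝ) + 1) := by
    rw [ae_all_iff]
    intro k
    rw [ae_all_iff]
    intro n
    have hA : MeasurableSet {ω | ‖(x : L0Vec P d) ω - (y n : L0Vec P d) ω‖ < δ k ω} :=
      measurableSet_lt ((x : L0Vec P d).measurable.sub (y n : L0Vec P d).measurable).norm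
        (δ k).measurable
    -- `y n` may be close to `x` only on the event `A`. Replacing it by `x` elsewhere puts it in the
    -- random ball, and locality carries the estimate back to `y n` on `A`.
    obtain ⟨z, hzG, hz⟩ := hG.exists_piecewise (y n).2 x.2 hA
    have hzb : z ∈ randomBall (x : L0Vec P d) (δ k) := by
      refine mem_randomBall.2 ?_
      filter_upwards [hz, hδ k] with ω h1 h2
      by_cases hω : ‖(x : L0Vec P d) ω - (y n : L0Vec P d) ω‖ < δ k ω
      · rwa [h1.1 hω]
      · rw [h1.2 hω]
        simpa using h2
    filter_upwards [mem_randomBall.1 (hδf k ⟨z, hzG⟩ hzb), hr k,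
      hf.congr_on hA (x := ⟨z, hzG⟩) (y := y n) (by filter_upwards [hz] with ω h1 using h1.1)]
      with ω h1 h2 h3 h4
    rwa [h3 h4, h2] at h1
  filter_upwards [hloc, h, ae_all_iff.2 hδ] with ω h1 h2 h3
  rw [Metric.tendsto_atTop']
  intro ε hε
  obtain ⟨k, hk⟩ := exists_nat_one_div_lt hε
  obtain ⟨n₀, hn₀⟩ := eventually_atTop.1
    ((tendsto_iff_norm_sub_tendsto_zero.1 h2).eventually_lt_const (h3 k))
  refine ⟨n₀, fun n hn => ?_⟩
  rw [dist_comm, dist_eq_norm]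
  refine (h1 k n ?_).trans hk
  rw [norm_sub_rev]
  exact hn₀ n hn.le

end RandomVectors

end RandomBrouwer

namespace RandomBrouwer

/-! ### Projection to `G` through the Hilbert space L² -/

section Projection

open Filter Topology

universe u

variable {Ω : Type u} [MeasurableSpace Ω] {P : Measure Ω} {d : ℕ}

theorem AsBounded.exists_bound {G : Set (L0Vec P d)} (hG : AsBounded G) :
    ∃ η : L0 P ℝ, ∀ y ∈ G, ∀ᵐ ω ∂P, ‖y ω‖ ≤ η ω := by
  obtain ⟨η, -, hη⟩ := hG
  refine ⟨η, fun y hy => ?_⟩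
  filter_upwards [AEEqFun.coeFn_le.2 (hη.1 (Set.mem_image_of_mem _ hy)), coeFn_l0Norm y,
    AEEqFun.coeFn_comp (fun a : ℝ => (a : EReal)) continuous_coe_real_ereal (l0Norm y),
    AEEqFun.coeFn_comp (fun a : ℝ => (a : EReal)) continuous_coe_real_ereal η] with ω h1 h2 h3 h4
  rw [toExtended, toExtended, h3, h4] at h1
  rw [← h2]
  exact EReal.coe_le_coe_iff.1 h1

theorem L0Convex.exists_convex_comb {G : Set (L0Vec P d)} (hG : L0Convex G) {y z : L0Vec P d}
    (hy : y ∈ G) (hz : z ∈ G) {a b : ℝ} (ha : 0 ≤ a) (hb : 0 ≤ b) (hab : a + b = 1) :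
    ∃ w ∈ G, ∀ᵐ ω ∂P, w ω = a • y ω + b • z ω := by
  have hc : AEEqFun.const (μ := P) Ω a =ᵐ[P] fun _ => a := AEEqFun.coeFn_const _ _
  refine ⟨_, hG y hy z hz (AEEqFun.const Ω a) ?_ ?_, ?_⟩
  · refine AEEqFun.coeFn_le.1 ?_
    filter_upwards [hc, AEEqFun.coeFn_zero (α := Ω) (β := ℝ) (μ := P)] with ω h1 h2
    rw [h1, h2]
    exact ha
  · refine AEEqFun.coeFn_le.1 ?_
    filter_upwards [hc, AEEqFun.coeFn_one (α := Ω) (β := ℝ) (μ := P)] with ω h1 h2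
    rw [h1, h2]
    exact (by linarith : a ≤ 1)
  · filter_upwards [hc, AEEqFun.coeFn_one (α := Ω) (β := ℝ) (μ := P),
      AEEqFun.coeFn_sub (1 : L0 P ℝ) (AEEqFun.const Ω a),
      coeFn_l0Smul (AEEqFun.const Ω a) y, coeFn_l0Smul (1 - AEEqFun.const Ω a) z,
      AEEqFun.coeFn_add (l0Smul (AEEqFun.const Ω a) y) (l0Smul (1 - AEEqFun.const Ω a) z)]
      with ω h1 h2 h3 h4 h5 h6
    rw [h6, Pi.add_apply, h4, h5, h3, Pi.sub_apply, h1, h2, Pi.one_apply, ← hab,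
      add_sub_cancel_left]

/-- Every random vector has a projection to a closed, bounded, convex set. -/
theorem exists_projection [IsProbabilityMeasure P] {G : Set (L0Vec P d)} (hne : G.Nonempty)
    (hstable : SigmaStable G) (hbdd : AsBounded G) (hclosed : TcClosed G) (hconv : L0Convex G)
    (x : L0Vec P d) :
    ∃ y ∈ G, ∀ z ∈ G, ∀ᵐ ω ∂P, inner ℝ (x ω - y ω) (z ω - y ω) ≤ 0 := by
  obtain ⟨η, hη⟩ := hbdd.exists_bound
  -- This random rescaling bounds `s • x` and all of `s • G` by 1, hence puts them in L², without
  -- changing the sign of the inner products at stake.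
  let s : Ω → ℝ := fun ω => (1 + ‖x ω‖ + |η ω|)⁻¹
  have hs : ∀ ω, 0 < s ω := fun ω => by positivity
  have hsm : Measurable s :=
    ((measurable_const.add x.measurable.norm).add η.measurable.abs).inv
  have hmem : ∀ z : L0Vec P d, (∀ᵐ ω ∂P, ‖z ω‖ ≤ ‖x ω‖ + |η ω|) →
      MemLp (fun ω => s ω • z ω) 2 P := fun z hz => by
    refine MemLp.of_bound (hsm.smul z.measurable).aestronglyMeasurable 1 ?_
    filter_upwards [hz] with ω h
    rw [norm_smul, Real.norm_of_nonneg (hs ω).le]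
    exact inv_mul_le_one_of_le₀ (by linarith) (by positivity)
  have hmemx := hmem x (ae_of_all _ fun ω => le_add_of_nonneg_right (abs_nonneg _))
  have hmemG : ∀ z ∈ G, MemLp (fun ω => s ω • z ω) 2 P := fun z hz => hmem z (by
    filter_upwards [hη z hz] with ω h
    linarith [le_abs_self (η ω), norm_nonneg (x ω)])
  let K : Set (Lp (EuclideanSpace ℝ (Fin d)) 2 P) :=
    {u | ∃ y ∈ G, u =ᵐ[P] fun ω => s ω • y ω}
  have hK : ∀ (z) (hz : z ∈ G), (hmemG z hz).toLp ∈ K := fun z hz =>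
    ⟨z, hz, MemLp.coeFn_toLp _⟩
  have hKne : K.Nonempty := hne.elim fun z hz => ⟨_, hK z hz⟩
  have hKconv : Convex ℝ K := by
    rintro u ⟨y, hy, hu⟩ v ⟨z, hz, hv⟩ a b ha hb hab
    obtain ⟨w, hw, hwe⟩ := hconv.exists_convex_comb hy hz ha hb hab
    refine ⟨w, hw, ?_⟩
    filter_upwards [hu, hv, hwe, Lp.coeFn_add (a • u) (b • v), Lp.coeFn_smul a u,
      Lp.coeFn_smul b v] with ω h1 h2 h3 h4 h5 h6
    rw [h4, Pi.add_apply, h5, h6, Pi.smul_apply, Pi.smul_apply, h1, h2, h3, smul_add,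
      smul_comm a, smul_comm b]
  have hKclosed : IsClosed K := by
    refine IsSeqClosed.isClosed fun u v hu huv => ?_
    obtain ⟨ns, -, hns⟩ := (tendstoInMeasure_of_tendsto_Lp huv).exists_seq_tendsto_ae
    choose y hy hyu using hu
    have hm : AEStronglyMeasurable (fun ω => (s ω)⁻¹ • v ω) P :=
      hsm.inv.aestronglyMeasurable.smul (Lp.aestronglyMeasurable v)
    refine ⟨AEEqFun.mk _ hm, hclosed.mem_of_tendsto hstable (fun i => hy (ns i)) ?_, ?_⟩
    · filter_upwards [hns, AEEqFun.coeFn_mk _ hm, ae_all_iff.2 hyu] with ω h1 h2 h3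
      rw [h2]
      refine (h1.const_smul (s ω)⁻¹).congr fun i => ?_
      rw [h3, inv_smul_smul₀ (hs ω).ne']
    · filter_upwards [AEEqFun.coeFn_mk _ hm] with ω h
      rw [h, smul_inv_smul₀ (hs ω).ne']
  obtain ⟨v, hv, hvmin⟩ := exists_norm_eq_iInf_of_complete_convex hKne hKclosed.isComplete hKconv
    hmemx.toLp
  rw [norm_eq_iInf_iff_real_inner_le_zero hKconv hv] at hvmin
  obtain ⟨y, hy, hvy⟩ := hv
  refine ⟨y, hy, fun z hz => ?_⟩
  have hA : MeasurableSet {ω | 0 < inner ℝ (x ω - y ω) (z ω - y ω)} :=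
    measurableSet_lt measurable_const
      ((x.measurable.sub y.measurable).inner (z.measurable.sub y.measurable))
  -- The Hilbert space gives only an integrated inequality. Testing it with `z` where the inner
  -- product is positive and `y` elsewhere makes the integrand nonnegative, so it vanishes almost
  -- surely.
  obtain ⟨w, hw, hwe⟩ := hstable.exists_piecewise hz hy hA
  have hint := hvmin _ (hK w hw)
  rw [L2.inner_def] at hint
  have heq : (fun ω => inner ℝ ((hmemx.toLp - v) ω) (((hmemG w hw).toLp - v) ω)) =ᵐ[P]
      fun ω => s ω * (s ω * inner ℝ (x ω - y ω) (w ω - y ω)) := by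
    filter_upwards [Lp.coeFn_sub hmemx.toLp v, Lp.coeFn_sub (hmemG w hw).toLp v,
      hmemx.coeFn_toLp, (hmemG w hw).coeFn_toLp, hvy] with ω h1 h2 h3 h4 h5
    rw [h1, h2, Pi.sub_apply, Pi.sub_apply, h3, h4, h5, ← smul_sub, ← smul_sub,
      real_inner_smul_left, real_inner_smul_right]
  have hnonneg : 0 ≤ᵐ[P] fun ω => inner ℝ ((hmemx.toLp - v) ω) (((hmemG w hw).toLp - v) ω) := by
    filter_upwards [heq, hwe] with ω h1 h2
    rw [h1]
    refine mul_nonneg (hs ω).le (mul_nonneg (hs ω).le ?_)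
    by_cases hω : 0 < inner ℝ (x ω - y ω) (z ω - y ω)
    · rw [h2.1 hω]
      exact hω.le
    · rw [h2.2 hω]
      simp
  have hzero := (integral_eq_zero_iff_of_nonneg_ae hnonneg (L2.integrable_inner _ _)).1
    (le_antisymm hint (integral_nonneg_of_ae hnonneg))
  filter_upwards [hzero, heq, hwe] with ω h1 h2 h3
  by_contra! hω
  rw [h2, h3.1 hω] at h1
  exact (mul_pos (hs ω) (mul_pos (hs ω) hω)).ne' h1

/-- Adding the two variational inequalities bounds ‖y - y'‖² by the inner product of x - x' and y -
y'; Cauchy–Schwarz finishes. -/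
theorem norm_sub_le_of_inner_le_zero {E : Type*} [NormedAddCommGroup E] [InnerProductSpace ℝ E]
    {x x' y y' : E} (h : inner ℝ (x - y) (y' - y) ≤ 0) (h' : inner ℝ (x' - y') (y - y') ≤ 0) :
    ‖y - y'‖ ≤ ‖x - x'‖ := by
  have key : ‖y - y'‖ * ‖y - y'‖ ≤ ‖x - x'‖ * ‖y - y'‖ := by
    refine le_trans ?_ (real_inner_le_norm (x - x') (y - y'))
    rw [← real_inner_self_eq_norm_mul_norm]
    simp only [inner_sub_left, inner_sub_right] at h h' ⊢
    linarith
  rcases (norm_nonneg (y - y')).eq_or_lt with h0 | h0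
  · rw [← h0]
    exact norm_nonneg _
  · exact le_of_mul_le_mul_right key h0

end Projection

end RandomBrouwer

namespace RandomBrouwer

/-! ### Random subsequences and the fixed point of a local map -/

section FixedPoint

open Filter Topology

universe u

variable {Ω : Type u} [MeasurableSpace Ω] {P : Measure Ω} {d : ℕ}

/-- The Bolzano–Weierstrass theorem for real random variables: an almost surely bounded sequence
converges along a measurable random subsequence. -/
theorem exists_random_subseq_real {u : ℕ → Ω → ℝ} (hu : ∀ n, Measurable (u n))
    (hb : ∀ᵐ ω ∂P, ∃ C, ∀ n, |u n ω| ≤ C) :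
    ∃ N : ℕ → Ω → ℕ, (∀ k, Measurable (N k)) ∧ (∀ᵐ ω ∂P, ∀ k, k ≤ N k ω) ∧
      ∀ᵐ ω ∂P, ∃ l, Tendsto (fun k => u (N k ω) ω) atTop (𝓝 l) := by
  -- The limsup is a cluster point that depends measurably on ω. The random indices chosen below
  -- need not increase; `k ≤ N k ω` suffices.
  let L : Ω → ℝ := fun ω => limsup (fun n => u n ω) atTop
  have hL : Measurable L := Measurable.limsup hu
  have hex : ∀ k : ℕ, ∃ N : Ω → ℕ, Measurable N ∧
      ∀ᵐ ω ∂P, k ≤ N ω ∧ |u (N ω) ω - L ω| < 1 / ((k : ℝ) + 1) := fun k => by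
    refine exists_measurable_index (M := fun n => {ω | k ≤ n ∧ |u n ω - L ω| < 1 / ((k : ℝ) + 1)})
      (fun n => (MeasurableSet.const _).inter
        (measurableSet_lt ((hu n).sub hL).abs measurable_const)) ?_
    filter_upwards [hb] with ω ⟨C, hC⟩
    have hpos : (0 : ℝ) < 1 / ((k : ℝ) + 1) := by positivity
    have hbdd : IsBoundedUnder (· ≤ ·) atTop fun n => u n ω :=
      isBoundedUnder_of ⟨C, fun n => (abs_le.1 (hC n)).2⟩
    have hbdd' : IsBoundedUnder (· ≥ ·) atTop fun n => u n ω :=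
      isBoundedUnder_of ⟨-C, fun n => (abs_le.1 (hC n)).1⟩
    have h1 : ∃ᶠ n in atTop, L ω - 1 / ((k : ℝ) + 1) < u n ω :=
      frequently_lt_of_lt_limsup hbdd'.isCoboundedUnder_le (sub_lt_self _ hpos)
    have h2 : ∀ᶠ n in atTop, u n ω < L ω + 1 / ((k : ℝ) + 1) :=
      eventually_lt_of_limsup_lt (lt_add_of_pos_right _ hpos) hbdd
    obtain ⟨n, hn1, hn2, hn3⟩ := (h1.and_eventually (h2.and (eventually_ge_atTop k))).exists
    exact ⟨n, hn3, abs_lt.2 ⟨by linarith, by linarith⟩⟩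
  choose N hN hNk using hex
  refine ⟨N, hN, ?_, ?_⟩
  · filter_upwards [ae_all_iff.2 hNk] with ω h k using (h k).1
  · filter_upwards [ae_all_iff.2 hNk] with ω h
    refine ⟨L ω, tendsto_iff_norm_sub_tendsto_zero.2 ?_⟩
    exact squeeze_zero (fun _ => norm_nonneg _) (fun k => (h k).2.le)
      tendsto_one_div_add_atTop_nhds_zero_nat

theorem measurable_apply_index {T E : Type*} [Countable T] [MeasurableSpace T]
    [MeasurableSingletonClass T] [MeasurableSpace E] {u : T → Ω → E} (hu : ∀ t, Measurable (u t))
    {N : Ω → T} (hN : Measurable N) : Measurable fun ω => u (N ω) ω :=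
  (measurable_from_prod_countable_right (f := fun p : T × Ω => u p.1 p.2) hu).comp
    (hN.prodMk measurable_id)

/-- Extraction one coordinate at a time: the new random indices tend to infinity, so limits already
obtained survive the composition. -/
theorem exists_random_subseq_coord {ι : Type*} {u : ℕ → Ω → ι → ℝ}
    (hu : ∀ n i, Measurable fun ω => u n ω i) (hb : ∀ᵐ ω ∂P, ∃ C, ∀ n i, |u n ω i| ≤ C)
    (s : Finset ι) :
    ∃ N : ℕ → Ω → ℕ, (∀ k, Measurable (N k)) ∧ (∀ᵐ ω ∂P, ∀ k, k ≤ N k ω) ∧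
      ∀ i ∈ s, ∀ᵐ ω ∂P, ∃ l, Tendsto (fun k => u (N k ω) ω i) atTop (𝓝 l) := by
  classical
  induction s using Finset.induction_on with
  | empty => exact ⟨fun k _ => k, fun _ => measurable_const, ae_of_all _ fun _ _ => le_rfl, by simp⟩
  | insert j s _ ih =>
    obtain ⟨N, hN, hNk, hlim⟩ := ih
    obtain ⟨M, hM, hMk, hMlim⟩ := exists_random_subseq_real (P := P)
      (u := fun k ω => u (N k ω) ω j) (fun k => measurable_apply_index (fun n => hu n j) (hN k)) (by
        filter_upwards [hb] with ω ⟨C, hC⟩ using ⟨C, fun n => hC _ j⟩)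
    refine ⟨fun k ω => N (M k ω) ω, fun k => measurable_apply_index hN (hM k), ?_, ?_⟩
    · filter_upwards [hNk, hMk] with ω h1 h2 k using (h2 k).trans (h1 _)
    · intro i hi
      rcases Finset.mem_insert.1 hi with rfl | hi
      · exact hMlim
      · filter_upwards [hlim i hi, hMk] with ω ⟨l, hl⟩ h2
        exact ⟨l, hl.comp (tendsto_atTop_mono h2 tendsto_id)⟩

theorem tendsto_euclidean {ι : Type*} {l : Filter ι} {v : ι → EuclideanSpace ℝ (Fin d)}
    {w : EuclideanSpace ℝ (Fin d)} (h : ∀ i, Tendsto (fun n => v n i) l (𝓝 (w i))) :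
    Tendsto v l (𝓝 w) :=
  ((PiLp.continuous_toLp 2 fun _ : Fin d => ℝ).tendsto w.ofLp).comp (tendsto_pi_nhds.2 h)

/-- The points of the lattice of mesh `2ρ / (n + 1)` with lower left corner `(-ρ, …, -ρ)`. -/
noncomputable def gridPoint (ρ : ℝ) (t : ℕ × (Fin d → ℕ)) : EuclideanSpace ℝ (Fin d) :=
  WithLp.toLp 2 fun i => ρ * (2 * (t.2 i : ℝ) / ((t.1 : ℝ) + 1) - 1)

theorem gridPoint_apply (ρ : ℝ) (t : ℕ × (Fin d → ℕ)) (i : Fin d) :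
    gridPoint ρ t i = ρ * (2 * (t.2 i : ℝ) / ((t.1 : ℝ) + 1) - 1) := rfl

theorem continuous_gridPoint (t : ℕ × (Fin d → ℕ)) : Continuous fun ρ => gridPoint ρ t := by
  unfold gridPoint
  fun_prop

theorem abs_gridPoint_le (ρ : ℝ) {n : ℕ} {q : Fin d → ℕ} {i : Fin d} (hq : q i < n + 1) :
    |gridPoint ρ (n, q) i| ≤ |ρ| := by
  rw [gridPoint_apply, abs_mul]
  refine mul_le_of_le_one_right (abs_nonneg _) (abs_le.2 ⟨?_, ?_⟩)
  · have : (0 : ℝ) ≤ 2 * (q i : ℝ) / ((n : ℝ) + 1) := by positivity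
    linarith
  · have h : (q i : ℝ) ≤ (n : ℝ) + 1 := by exact_mod_cast hq.le
    have : 2 * (q i : ℝ) / ((n : ℝ) + 1) ≤ 2 := by
      rw [div_le_iff₀ (by positivity)]
      linarith
    linarith

theorem abs_gridPoint_sub_le (ρ : ℝ) {n : ℕ} {q r : Fin d → ℕ} {i : Fin d} (h1 : q i ≤ r i)
    (h2 : r i ≤ q i + 1) :
    |gridPoint ρ (n, r) i - gridPoint ρ (n, q) i| ≤ |ρ| * 2 * (1 / ((n : ℝ) + 1)) := by
  have h : gridPoint ρ (n, r) i - gridPoint ρ (n, q) i =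
      ρ * 2 * (((r i : ℝ) - q i) * (1 / ((n : ℝ) + 1))) := by
    rw [gridPoint_apply, gridPoint_apply]
    ring
  have h1' : (q i : ℝ) ≤ r i := by exact_mod_cast h1
  have h2' : (r i : ℝ) ≤ q i + 1 := by exact_mod_cast h2
  have hn : (0 : ℝ) ≤ 1 / ((n : ℝ) + 1) := by positivity
  rw [h, abs_mul, abs_mul, abs_two, abs_mul, abs_of_nonneg hn]
  refine mul_le_mul_of_nonneg_left (mul_le_of_le_one_left hn ?_) (by positivity)
  exact abs_le.2 ⟨by linarith, by linarith⟩

/-- A map on random vectors which is local, respects almost sure convergence and has bounded range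
has a fixed point. -/
theorem exists_fixedPoint_of_local [IsProbabilityMeasure P] {g : L0Vec P d → L0Vec P d}
    (hloc : ∀ (A : Set Ω) (x y : L0Vec P d), MeasurableSet A →
      (∀ᵐ ω ∂P, ω ∈ A → x ω = y ω) → ∀ᵐ ω ∂P, ω ∈ A → g x ω = g y ω)
    (hcont : ∀ (y : ℕ → L0Vec P d) (x : L0Vec P d),
      (∀ᵐ ω ∂P, Tendsto (fun n => y n ω) atTop (𝓝 (x ω))) →
        ∀ᵐ ω ∂P, Tendsto (fun n => g (y n) ω) atTop (𝓝 (g x ω)))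
    {ρ : Ω → ℝ} (hρ : Measurable ρ) (hbdd : ∀ x, ∀ᵐ ω ∂P, ∀ i, |g x ω i| < ρ ω) :
    ∃ x, g x = x := by
  have hXm : ∀ t : ℕ × (Fin d → ℕ), Measurable fun ω => gridPoint (ρ ω) t := fun t =>
    (continuous_gridPoint t).measurable.comp hρ
  let X : ℕ × (Fin d → ℕ) → L0Vec P d := fun t => AEEqFun.mk _ (hXm t).aestronglyMeasurable
  have hX : ∀ᵐ ω ∂P, ∀ t, X t ω = gridPoint (ρ ω) t :=
    ae_all_iff.2 fun t => AEEqFun.coeFn_mk _ _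
  have hcoord : ∀ (x : L0Vec P d) (i : Fin d), Measurable fun ω => x ω i := fun x i =>
    (EuclideanSpace.proj (𝕜 := ℝ) i).continuous.measurable.comp x.measurable
  have hcell : ∀ n : ℕ, ∃ τ : Ω → (Fin d → ℕ) × (Fin d → Fin d → ℕ) × (Fin d → Fin d → ℕ),
      Measurable τ ∧ ∀ᵐ ω ∂P, ((∀ i, (τ ω).1 i < n + 1) ∧
        (∀ j i, (τ ω).1 i ≤ (τ ω).2.1 j i ∧ (τ ω).2.1 j i ≤ (τ ω).1 i + 1) ∧
        (∀ j i, (τ ω).1 i ≤ (τ ω).2.2 j i ∧ (τ ω).2.2 j i ≤ (τ ω).1 i + 1)) ∧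
        ∀ j, X (n, (τ ω).2.1 j) ω j ≤ g (X (n, (τ ω).2.1 j)) ω j ∧
          g (X (n, (τ ω).2.2 j)) ω j < X (n, (τ ω).2.2 j) ω j := fun n => by
    refine exists_measurable_index (M := fun t : (Fin d → ℕ) × (Fin d → Fin d → ℕ) × (Fin d → Fin d → ℕ) =>
      {ω | ((∀ i, t.1 i < n + 1) ∧
        (∀ j i, t.1 i ≤ t.2.1 j i ∧ t.2.1 j i ≤ t.1 i + 1) ∧
        (∀ j i, t.1 i ≤ t.2.2 j i ∧ t.2.2 j i ≤ t.1 i + 1)) ∧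
        ∀ j, X (n, t.2.1 j) ω j ≤ g (X (n, t.2.1 j)) ω j ∧
          g (X (n, t.2.2 j)) ω j < X (n, t.2.2 j) ω j}) (fun t => ?_) ?_
    · refine (MeasurableSet.const _).inter ?_
      refine measurableSet_setOfPred.2 (Measurable.forall fun j => measurableSet_setOfPred.1 ?_)
      exact (measurableSet_le (hcoord _ j) (hcoord _ j)).inter
        (measurableSet_lt (hcoord _ j) (hcoord _ j))
    · filter_upwards [hX, ae_all_iff.2 fun t => hbdd (X t)] with ω h1 h2
      -- A lattice point has label `j` when `g` strictly decreases its `j`th coordinate. The bound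
      -- on `g` rules this out on the face at -ρ and, being strict, forces it on the face at ρ.
      obtain ⟨q, hq, hrs⟩ := exists_kuhn_cell (p := n + 1)
        (S := fun j k => g (X (n, k)) ω j < X (n, k) ω j) (fun j k hk => by
          have := abs_lt.1 (h2 (n, k) j)
          rw [h1, gridPoint_apply, not_lt]
          simp only [hk]
          simp
          linarith) (fun j k hk => by
          have := abs_lt.1 (h2 (n, k) j)
          have hn : (n : ℝ) + 1 ≠ 0 := by positivity
          rw [h1, gridPoint_apply]
          simp only [hk]
          push_cast
          rw [mul_div_assoc, div_self hn]
          linarith)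
      choose r s hr hs hSr hSs using hrs
      exact ⟨(q, r, s), ⟨hq, hr, hs⟩, fun j => ⟨not_lt.1 (hSr j), hSs j⟩⟩
  choose τ hτm hτ using hcell
  have hτ' := ae_all_iff.2 hτ
  have hum : ∀ n, Measurable fun ω => gridPoint (ρ ω) (n, (τ n ω).1) := fun n =>
    measurable_apply_index hXm (measurable_const.prodMk (hτm n).fst)
  obtain ⟨N, hN, hNk, hlim⟩ := exists_random_subseq_coord (P := P)
    (u := fun n ω => (gridPoint (ρ ω) (n, (τ n ω).1)).ofLp)
    (fun n i => (EuclideanSpace.proj (𝕜 := ℝ) i).continuous.measurable.comp (hum n)) (by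
      filter_upwards [hτ'] with ω h
      exact ⟨|ρ ω|, fun n i => abs_gridPoint_le _ ((h n).1.1 i)⟩) Finset.univ
  obtain ⟨x₀, hx₀m, hx₀⟩ := measurable_limit_of_tendsto_metrizable_ae (μ := P) (L := atTop)
    (f := fun k ω => gridPoint (ρ ω) (N k ω, (τ (N k ω) ω).1))
    (fun k => (measurable_apply_index hum (hN k)).aemeasurable) (by
      filter_upwards [ae_all_iff.2 fun i => hlim i (Finset.mem_univ i)] with ω h
      choose l hl using h
      exact ⟨WithLp.toLp 2 l, tendsto_euclidean hl⟩)
  let x : L0Vec P d := AEEqFun.mk _ hx₀m.aestronglyMeasurable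
  have hx : x =ᵐ[P] x₀ := AEEqFun.coeFn_mk _ _
  -- Any measurable choice of corners has the same limit `x`, as the mesh tends to 0. The corners
  -- are glued into genuine random vectors `y k` so that `hcont` applies; `hloc` evaluates `g (y k)`
  -- on each event where the random index is constant.
  have hvertex : ∀ J : ℕ → Ω → Fin d → ℕ, (∀ n, Measurable (J n)) →
      (∀ᵐ ω ∂P, ∀ n i, (τ n ω).1 i ≤ J n ω i ∧ J n ω i ≤ (τ n ω).1 i + 1) →
      ∀ᵐ ω ∂P, Tendsto (fun k => X (N k ω, J (N k ω) ω) ω) atTop (𝓝 (x ω)) ∧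
        Tendsto (fun k => g (X (N k ω, J (N k ω) ω)) ω) atTop (𝓝 (g x ω)) := by
    intro J hJ hJτ
    have hidx : ∀ k, Measurable fun ω => (N k ω, J (N k ω) ω) := fun k =>
      (hN k).prodMk (measurable_apply_index hJ (hN k))
    choose y hy using fun k => exists_glue (P := P) (hidx k) X
    have hgy : ∀ᵐ ω ∂P, ∀ k, g (y k) ω = g (X (N k ω, J (N k ω) ω)) ω := by
      refine ae_all_iff.2 fun k => ?_
      have := ae_all_iff.2 fun t => hloc ((fun ω => (N k ω, J (N k ω) ω)) ⁻¹' {t}) (y k) (X t)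
        (hidx k (measurableSet_singleton t)) (by
          filter_upwards [hy k] with ω h1 h2
          rw [h1, show (N k ω, J (N k ω) ω) = t from h2])
      filter_upwards [this] with ω h
      exact h _ rfl
    have hytend : ∀ᵐ ω ∂P, Tendsto (fun k => y k ω) atTop (𝓝 (x ω)) := by
      filter_upwards [ae_all_iff.2 hy, hx, hx₀, hX, hJτ, hNk] with ω h1 h2 h3 h4 h5 h6
      simp only [h1, h2, h4]
      refine tendsto_euclidean fun i => ?_
      have hi := ((EuclideanSpace.proj (𝕜 := ℝ) i).continuous.tendsto (x₀ ω)).comp h3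
      refine tendsto_of_tendsto_of_dist hi ?_
      have h0 : Tendsto (fun k : ℕ => |ρ ω| * 2 * (1 / ((N k ω : ℝ) + 1))) atTop (𝓝 0) := by
        simpa using (tendsto_one_div_add_atTop_nhds_zero_nat.comp
          (tendsto_atTop_mono h6 tendsto_id)).const_mul (|ρ ω| * 2)
      refine squeeze_zero (fun _ => dist_nonneg) (fun k => ?_) h0
      rw [dist_comm, Real.dist_eq]
      exact abs_gridPoint_sub_le _ (h5 _ i).1 (h5 _ i).2
    filter_upwards [ae_all_iff.2 hy, hgy, hytend, hcont y x hytend] with ω h1 h2 h3 h4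
    exact ⟨h3.congr h1, h4.congr h2⟩
  refine ⟨x, AEEqFun.ext ?_⟩
  have hr := ae_all_iff.2 fun j => hvertex (fun n ω => (τ n ω).2.1 j)
    (fun n => (measurable_pi_apply j).comp (hτm n).snd.fst) (by
      filter_upwards [hτ'] with ω h n i using (h n).1.2.1 j i)
  have hs := ae_all_iff.2 fun j => hvertex (fun n ω => (τ n ω).2.2 j)
    (fun n => (measurable_pi_apply j).comp (hτm n).snd.snd) (by
      filter_upwards [hτ'] with ω h n i using (h n).1.2.2 j i)
  filter_upwards [hτ', hr, hs] with ω h1 h2 h3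
  ext j
  have hproj : ∀ {v : ℕ → EuclideanSpace ℝ (Fin d)} {w : EuclideanSpace ℝ (Fin d)},
      Tendsto v atTop (𝓝 w) → Tendsto (fun k => v k j) atTop (𝓝 (w j)) := fun hv =>
    ((EuclideanSpace.proj (𝕜 := ℝ) j).continuous.tendsto _).comp hv
  -- The corners moved down give the upper bound for `g x`, those moved up the lower bound.
  refine le_antisymm ?_ ?_
  · exact le_of_tendsto_of_tendsto' (hproj (h3 j).2) (hproj (h3 j).1)
      fun k => ((h1 (N k ω)).2 j).2.le
  · exact le_of_tendsto_of_tendsto' (hproj (h2 j).1) (hproj (h2 j).2)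
      fun k => ((h1 (N k ω)).2 j).1

end FixedPoint

end RandomBrouwer

/-! ### Brouwer's theorem on `G` by composition with the projection -/

theorem mainTheorem3 {Ω : Type*} [MeasurableSpace Ω] (P : MeasureTheory.Measure Ω)
    [MeasureTheory.IsProbabilityMeasure P] (d : ℕ) (G : Set (RandomBrouwer.L0Vec P d))
    (hne : G.Nonempty) (hstable : RandomBrouwer.SigmaStable G)
    (hbdd : RandomBrouwer.AsBounded G) (hclosed : RandomBrouwer.TcClosed G)
    (hconv : RandomBrouwer.L0Convex G) (f : G → G)
    (hf : RandomBrouwer.SigmaStableMap hstable f) (hcont : RandomBrouwer.TcContinuous f) :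
    ∃ x : G, f x = x := by
  choose r hrG hr using RandomBrouwer.exists_projection hne hstable hbdd hclosed hconv
  have hlip : ∀ x y, ∀ᵐ ω ∂P, ‖r x ω - r y ω‖ ≤ ‖x ω - y ω‖ := fun x y => by
    filter_upwards [hr x (r y) (hrG y), hr y (r x) (hrG x)] with ω h1 h2
    exact RandomBrouwer.norm_sub_le_of_inner_le_zero h1 h2
  obtain ⟨η, hη⟩ := hbdd.exists_bound
  obtain ⟨x, hx⟩ := RandomBrouwer.exists_fixedPoint_of_local
    (g := fun x => (f ⟨r x, hrG x⟩ : RandomBrouwer.L0Vec P d))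
    (fun A x y hA h => hf.congr_on hA (by
      filter_upwards [hlip x y, h] with ω h1 h2 hω
      rw [h2 hω, sub_self, norm_zero] at h1
      exact sub_eq_zero.1 (norm_le_zero_iff.1 h1)))
    (fun y x h => hcont.tendsto_ae hf (by
      filter_upwards [h, ae_all_iff.2 fun n => hlip (y n) x] with ω h1 h2
      rw [tendsto_iff_norm_sub_tendsto_zero] at h1 ⊢
      exact squeeze_zero (fun _ => norm_nonneg _) h2 h1))
    -- Adding 1 makes the coordinate bound strict.
    (ρ := fun ω => η ω + 1) (η.measurable.add measurable_const) (fun x => by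
      filter_upwards [hη _ (f ⟨r x, hrG x⟩).2] with ω h i
      refine lt_of_le_of_lt (le_trans ?_ h) (lt_add_one _)
      simpa using PiLp.norm_apply_le ((f ⟨r x, hrG x⟩ : RandomBrouwer.L0Vec P d) ω) i)
  have hxG : x ∈ G := hx ▸ (f ⟨r x, hrG x⟩).2
  -- Taking `z = x` in the variational inequality gives ‖x - r x‖² ≤ 0.
  have hrx : r x = x := by
    refine AEEqFun.ext ?_
    filter_upwards [hr x x hxG] with ω h
    exact (sub_eq_zero.1 (inner_self_eq_zero.1 (le_antisymm h real_inner_self_nonneg))).symm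
  refine ⟨⟨x, hxG⟩, Subtype.ext ?_⟩
  have : (⟨r x, hrG x⟩ : G) = ⟨x, hxG⟩ := Subtype.ext hrx
  rw [← this]
  exact hx.trans hrx.symm
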